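/- Throughout, $x\cdot y$ and $|x|$ are the Euclidean scalar product and norm on $\mathbb{R}^d$, $\langle A,B\rangle_{\mathrm{HS}}=\sum_{i,j}A_{ij}B_{ij}$ is the Hilbert–Schmidt scalar product on real $d\times d$ matrices, and $\|A\|_{\mathrm{HS}}^2=\langle A,A\rangle_{\mathrm{HS}}$. For a probability measure $\nu$ on $\mathbb{R}^d$, let $W^{1,2}_\nu$ be the space of vector-valued functions $\varphi:\mathbb{R}^d\to\mathbb{R}^d$ obtained as the closure of the smooth functions $f:\mathbb{R}^d\to\mathbb{R}^d$ with $f,\nabla f\in L^2(\nu)$ for the Sobolev norm $\left(\int(|f|^2+\|\nabla f\|_{\mathrm{HS}}^2)\,d\nu\right)^{1/2}$, with $\nabla\varphi$ the $L^2(\nu)$-limit of the gradients. A matrix-valued function $\tau\in L^2(\nu)$ is a *Stein kernel* for $\nu$ if, for every $\varphi\in W^{1,2}_\nu$, both integrals below converge and $$\int x\cdot\varphi\,d\nu=\int\langle\tau,\nabla\varphi\rangle_{\mathrm{HS}}\,d\nu .$$ **Corollary 2.4** (Stein kernels for heavy-tailed examples). Stein kernels exist for the following probability measures on $\mathbb{R}^d$.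 (i) The generalized Cauchy distributions $\nu_\beta(dx)=Z^{-1}(1+|x|^2)^{-\beta}\,dx$ with $\beta>\max\left(\frac{d+4}{2},d\right)$ (the normalization $Z$ is finite for these $\beta$). (ii) Every centered probability measure (that is, $\int x\,d\nu=0$) of the form $\nu(dx)=Z^{-1}e^{-V(x)^p}\,dx$ with $V:\mathbb{R}^d\to[0,\infty)$ convex and $p>0$, as soon as $\int|x|^{2+2(1-p)}\,d\nu<\infty$. In particular, Stein kernels exist for the probability measures with density proportional to $e^{-|x|^p}$ with $p\in(0,1)$ (which are indeed normalizable). -/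

import Mathlib

open MeasureTheory Filter Topology

noncomputable section

namespace SteinKernel

/-- The Hilbert–Schmidt scalar product of two real `d × d` matrices. -/
def hsInner {d : ℕ} (A B : Matrix (Fin d) (Fin d) ℝ) : ℝ :=
  ∑ i, ∑ j, A i j * B i j

/-- The matrix `∇φ(x)`, with `(i, j)` entry `∂ⱼφᵢ(x)`. -/
def grad {d : ℕ} (φ : EuclideanSpace ℝ (Fin d) → EuclideanSpace ℝ (Fin d))
    (x : EuclideanSpace ℝ (Fin d)) : Matrix (Fin d) (Fin d) ℝ :=
  Matrix.of fun i j => (fderiv ℝ φ x (EuclideanSpace.single j 1)) i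

/-- `F ∈ L²(ν)` for a matrix-valued function `F`, expressed entrywise. -/
def MatrixMemL2 {d : ℕ} (ν : Measure (EuclideanSpace ℝ (Fin d)))
    (F : EuclideanSpace ℝ (Fin d) → Matrix (Fin d) (Fin d) ℝ) : Prop :=
  ∀ i j, MemLp (fun x => F x i j) 2 ν

/-- The squared Sobolev norm `∫ (|f|² + ‖F‖²_HS) dν` of a pair of square-integrable functions
`(f, F)`, where `F` plays the role of `∇f`. -/
def sobolevNormSq {d : ℕ} (ν : Measure (EuclideanSpace ℝ (Fin d)))
    (f : EuclideanSpace ℝ (Fin d) → EuclideanSpace ℝ (Fin d))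
    (F : EuclideanSpace ℝ (Fin d) → Matrix (Fin d) (Fin d) ℝ) : ℝ :=
  ∫ x, (‖f x‖ ^ 2 + hsInner (F x) (F x)) ∂ν

/-- `φ` belongs to the Sobolev space `W^{1,2}_ν` of vector-valued functions, with gradient `G`:
the pair `(φ, G)` is the limit, in the Sobolev norm, of pairs `(u, ∇u)` with `u` smooth and
`u, ∇u ∈ L²(ν)`. -/
structure MemSobolev {d : ℕ} (ν : Measure (EuclideanSpace ℝ (Fin d)))
    (φ : EuclideanSpace ℝ (Fin d) → EuclideanSpace ℝ (Fin d))
    (G : EuclideanSpace ℝ (Fin d) → Matrix (Fin d) (Fin d) ℝ) : Prop where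
  memLp : MemLp φ 2 ν
  memLp_grad : MatrixMemL2 ν G
  exists_approx : ∃ u : ℕ → EuclideanSpace ℝ (Fin d) → EuclideanSpace ℝ (Fin d),
    (∀ n, ContDiff ℝ (⊤ : ℕ∞) (u n)) ∧
    (∀ n, MemLp (u n) 2 ν) ∧
    (∀ n, MatrixMemL2 ν (grad (u n))) ∧
    Tendsto (fun n => sobolevNormSq ν (fun x => u n x - φ x) (fun x => grad (u n) x - G x))
      atTop (𝓝 0)

/-- `τ` is a Stein kernel for `ν`: it is square integrable, and
`∫ x · φ dν = ∫ ⟨τ, ∇φ⟩_HS dν` for every `φ ∈ W^{1,2}_ν`, both integrals being convergent. -/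
structure IsSteinKernel {d : ℕ} (ν : Measure (EuclideanSpace ℝ (Fin d)))
    (τ : EuclideanSpace ℝ (Fin d) → Matrix (Fin d) (Fin d) ℝ) : Prop where
  memLp : MatrixMemL2 ν τ
  integrable_left : ∀ φ G, MemSobolev ν φ G → Integrable (fun x => inner ℝ x (φ x)) ν
  integrable_right : ∀ φ G, MemSobolev ν φ G → Integrable (fun x => hsInner (τ x) (G x)) ν
  integral_eq : ∀ φ G, MemSobolev ν φ G →
    ∫ x, inner ℝ x (φ x) ∂ν = ∫ x, hsInner (τ x) (G x) ∂ν

/-- The measure `Z⁻¹ f(x) dx` with `Z = ∫ f(x) dx`. For a nonnegative measurable `f` it is a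
probability measure exactly when `0 < Z < ∞`. -/
def normalizedMeasure {d : ℕ} (f : EuclideanSpace ℝ (Fin d) → ℝ) :
    Measure (EuclideanSpace ℝ (Fin d)) :=
  volume.withDensity fun x => ENNReal.ofReal ((∫ y, f y)⁻¹ * f x)

/-- The generalized Cauchy distribution `ν_β(dx) = Z⁻¹ (1 + |x|²)^{-β} dx` on `ℝᵈ`. -/
def generalizedCauchy (d : ℕ) (β : ℝ) : Measure (EuclideanSpace ℝ (Fin d)) :=
  normalizedMeasure fun x => (1 + ‖x‖ ^ 2) ^ (-β)

/-- The measure `Z⁻¹ e^{-V(x)^p} dx` on `ℝᵈ`. -/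
def expPowMeasure {d : ℕ} (V : EuclideanSpace ℝ (Fin d) → ℝ) (p : ℝ) :
    Measure (EuclideanSpace ℝ (Fin d)) :=
  normalizedMeasure fun x => Real.exp (-(V x) ^ p)

end SteinKernel

end

/-! The proof rests on a converse weighted Poincaré inequality: for a suitable density `ρ` there is
a constant `K` such that every smooth `f` admits a constant `c` with
`∫ |f - c|² / (1 + |x|²) ρ dx ≤ K ∫ |∇f|² ρ dx`. If the mean is zero and the fourth moment is
finite, then `∫ x · u dν = ∫ x · (u - c) dν` is bounded, by the Cauchy–Schwarz inequality, by a
multiple of the `L²(ν)` norm of `∇u`, so that the Riesz representation theorem gives `τ` with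
`∫ x · u dν = ∫ ⟨τ, ∇u⟩ dν` for smooth `u`; both sides being continuous in the Sobolev norm, this
passes to the closure (`SteinKernel.exists_isSteinKernel_of_le`).

Only one property of `ρ` besides continuity and positivity is used for the inequality
(`RadialDecay`): `l ^ d * ρ (l x) ≤ l * ρ x` for `|x| ≥ R` and `1 ≤ l ≤ 2`, that is, decay at least
like `|x| ^ (1 - d)` along rays. On the ball of radius `2R`, where `ρ` is comparable to a constant,
the Poincaré inequality for Lebesgue measure holds (`exists_lintegral_ball_sub_sq_le`). Outside it,
write `f x - c = (f (x / 2) - c) + (f x - f (x / 2))`: after the change of variables `y = x / 2`, the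
decay makes the first term a strict contraction of the left-hand side, up to the part of the
integral that lies in the ball, while the second is controlled by `∇f` on the segment from `x / 2` to
`x` (`RadialDecay.lintegral_outside_le`).

The generalized Cauchy densities satisfy the decay condition with `R = 1`. For `exp (-V ^ p)`, finite
mass bounds the sublevel sets of the convex function `V`, so that `V` grows at least linearly
(`SteinKernel.exists_norm_le_mul_of_integrable`); convexity then makes `V ^ p` grow along rays faster
than any multiple of the logarithm (`SteinKernel.pow_mul_exp_neg_rpow_le`), and all moments are
finite. -/

/-! ### The Poincaré inequality on a ball -/

section ConversePoincare

variable {E F : Type*} [NormedAddCommGroup E] [NormedSpace ℝ E] [NormedAddCommGroup F]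
  [NormedSpace ℝ F]

/-- Jensen's inequality for the square. -/
theorem sq_lintegral_le_lintegral_sq {α : Type*} [MeasurableSpace α] (μ : Measure α)
    [IsProbabilityMeasure μ] {g : α → ENNReal} (hg : AEMeasurable g μ) :
    (∫⁻ a, g a ∂μ) ^ 2 ≤ ∫⁻ a, g a ^ 2 ∂μ := by
  have h := ENNReal.lintegral_mul_le_Lp_mul_Lq μ Real.HolderConjugate.two_two hg
    (aemeasurable_const (b := (1 : ENNReal)))
  simp only [Pi.mul_apply, mul_one, ENNReal.one_rpow, lintegral_const, measure_univ] at h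
  calc (∫⁻ a, g a ∂μ) ^ 2 ≤ ((∫⁻ a, g a ^ (2 : ℝ) ∂μ) ^ (1 / 2 : ℝ)) ^ 2 := by gcongr
    _ = ∫⁻ a, g a ^ 2 ∂μ := by
      rw [← ENNReal.rpow_natCast, ← ENNReal.rpow_mul]
      norm_num

theorem enorm_sub_sq_le_lintegral_fderiv [CompleteSpace F] {f : E → F} (hf : ContDiff ℝ 1 f)
    (x y : E) :
    ‖f y - f x‖ₑ ^ 2 ≤
      ‖y - x‖ₑ ^ 2 * ∫⁻ t in Set.Icc (0 : ℝ) 1, ‖fderiv ℝ f (x + t • (y - x))‖ₑ ^ 2 := by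
  have hd : ∀ t : ℝ, HasDerivAt (fun t : ℝ => f (x + t • (y - x)))
      (fderiv ℝ f (x + t • (y - x)) (y - x)) t := fun t => by
    have h1 : HasDerivAt (fun t : ℝ => x + t • (y - x)) (y - x) t := by
      simpa using ((hasDerivAt_id t).smul_const (y - x)).const_add x
    exact ((hf.differentiable one_ne_zero _).hasFDerivAt).comp_hasDerivAt t h1
  have hc : ContDiff ℝ 1 (fun t : ℝ => f (x + t • (y - x))) := by fun_prop
  have h := enorm_sub_le_lintegral_deriv_of_contDiffOn_Icc hc.contDiffOn zero_le_one
  simp only [one_smul, zero_smul, add_zero, add_sub_cancel, fun t => (hd t).deriv] at h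
  have hm : Continuous fun t : ℝ => ‖fderiv ℝ f (x + t • (y - x))‖ₑ := by
    have := hf.continuous_fderiv one_ne_zero
    fun_prop
  have : IsProbabilityMeasure (volume.restrict (Set.Icc (0 : ℝ) 1)) := ⟨by simp⟩
  calc ‖f y - f x‖ₑ ^ 2
      ≤ (∫⁻ t in Set.Icc (0 : ℝ) 1, ‖fderiv ℝ f (x + t • (y - x))‖ₑ * ‖y - x‖ₑ) ^ 2 := by
        gcongr
        refine h.trans (lintegral_mono fun t => ?_)
        exact ContinuousLinearMap.le_opENorm _ _
    _ = ‖y - x‖ₑ ^ 2 * (∫⁻ t in Set.Icc (0 : ℝ) 1, ‖fderiv ℝ f (x + t • (y - x))‖ₑ) ^ 2 := by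
        rw [lintegral_mul_const _ hm.measurable, mul_pow, mul_comm]
    _ ≤ _ := by
        gcongr
        exact sq_lintegral_le_lintegral_sq _ hm.measurable.aemeasurable

variable [FiniteDimensional ℝ E] [MeasurableSpace E] [BorelSpace E] (μ : Measure E)
  [μ.IsAddHaarMeasure]

open Module in
theorem ofReal_pow_mul_lintegral_comp_smul_add {s : ℝ} (hs : 0 < s) (b : E) {h : E → ENNReal}
    (hh : Measurable h) :
    ENNReal.ofReal s ^ finrank ℝ E * ∫⁻ x, h (s • x + b) ∂μ = ∫⁻ x, h x ∂μ := by
  have h1 : ∫⁻ x, h (s • x + b) ∂μ = ENNReal.ofReal |(s ^ finrank ℝ E)⁻¹| * ∫⁻ x, h x ∂μ := by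
    have h2 := lintegral_map (μ := μ) (hh.comp (measurable_add_const b))
      (measurable_const_smul (α := E) s)
    rw [Measure.map_addHaar_smul μ hs.ne', lintegral_smul_measure] at h2
    simp only [Function.comp_apply, lintegral_add_right_eq_self, smul_eq_mul] at h2
    exact h2.symm
  rw [h1, ← mul_assoc, ← ENNReal.ofReal_pow hs.le, ← ENNReal.ofReal_mul (by positivity),
    abs_of_pos (by positivity), mul_inv_cancel₀ (by positivity), ENNReal.ofReal_one, one_mul]

open Module in
/-- If `s • B + b ⊆ B` and `s ≥ 1/2`, the substitution `x ↦ s • x + b` costs at most the Jacobian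
factor `2 ^ dim E`. -/
theorem setLIntegral_comp_smul_add_le {s : ℝ} (hs : 1 / 2 ≤ s) (b : E) {B : Set E}
    (hB : MeasurableSet B) (hsB : ∀ x ∈ B, s • x + b ∈ B) {h : E → ENNReal} (hh : Measurable h) :
    ∫⁻ x in B, h (s • x + b) ∂μ ≤ 2 ^ finrank ℝ E * ∫⁻ x in B, h x ∂μ := by
  have h1 := ofReal_pow_mul_lintegral_comp_smul_add μ (by linarith) b (hh.indicator hB)
    (s := s)
  rw [← lintegral_indicator hB (f := h), ← h1, ← mul_assoc, ← mul_pow]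
  have h2 : (1 : ENNReal) ≤ (2 * ENNReal.ofReal s) ^ finrank ℝ E := by
    apply one_le_pow₀
    rw [← ENNReal.ofReal_ofNat 2, ← ENNReal.ofReal_mul (by norm_num)]
    exact ENNReal.one_le_ofReal.2 (by linarith)
  refine le_trans ?_ (le_mul_of_one_le_left' h2)
  rw [← lintegral_indicator hB]
  refine lintegral_mono fun x => ?_
  by_cases hx : x ∈ B
  · simp [hx, hsB x hx]
  · simp [hx]

open Module in
theorem lintegral_lintegral_ball_sub_sq_le [CompleteSpace F] {f : E → F} (hf : ContDiff ℝ 1 f)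
    (r : ℝ) :
    ∫⁻ y in Metric.ball 0 r, ∫⁻ x in Metric.ball 0 r, ‖f x - f y‖ₑ ^ 2 ∂μ ∂μ ≤
      ENNReal.ofReal (2 * r) ^ 2 * 2 ^ finrank ℝ E * μ (Metric.ball 0 r) *
        ∫⁻ x in Metric.ball 0 r, ‖fderiv ℝ f x‖ₑ ^ 2 ∂μ := by
  set B : Set E := Metric.ball 0 r with hBdef
  have hBm : MeasurableSet B := measurableSet_ball
  have hBc : Convex ℝ B := convex_ball 0 r
  set H : E → ENNReal := fun x => ‖fderiv ℝ f x‖ₑ ^ 2 with hH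
  have hcont : Continuous (fderiv ℝ f) := hf.continuous_fderiv one_ne_zero
  have hHc : Continuous H := by
    have : Continuous fun x => ‖fderiv ℝ f x‖ₑ := hcont.enorm
    exact (ENNReal.continuous_pow 2).comp this
  have hHm : Measurable H := hHc.measurable
  set I := ∫⁻ x in B, H x ∂μ with hI
  have hpt : ∀ y ∈ B, ∀ x ∈ B, ‖f x - f y‖ₑ ^ 2 ≤ ENNReal.ofReal (2 * r) ^ 2 *
      ∫⁻ t in Set.Icc (0 : ℝ) 1, H (y + t • (x - y)) := fun y hy x hx => by
    refine (enorm_sub_sq_le_lintegral_fderiv hf y x).trans ?_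
    gcongr
    rw [← ofReal_norm]
    apply ENNReal.ofReal_le_ofReal
    have h1 : ‖x‖ < r := by simpa [hBdef] using hx
    have h2 : ‖y‖ < r := by simpa [hBdef] using hy
    linarith [norm_sub_le x y]
  -- For a fixed parameter, integrate first over the endpoint whose coefficient is at least `1/2`.
  have ht : ∀ t ∈ Set.Icc (0 : ℝ) 1,
      ∫⁻ y in B, ∫⁻ x in B, H (y + t • (x - y)) ∂μ ∂μ ≤ μ B * (2 ^ finrank ℝ E * I) := by
    intro t ht
    rcases le_total (1 / 2) t with h | h
    · calc _ ≤ ∫⁻ y in B, 2 ^ finrank ℝ E * I ∂μ := by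
            refine setLIntegral_mono' hBm fun y hy => ?_
            have := setLIntegral_comp_smul_add_le μ h ((1 - t) • y) hBm (fun x hx =>
              hBc hx hy ht.1 (by linarith [ht.2]) (by ring)) hHm
            refine le_trans (le_of_eq ?_) this
            congr! 3
            module
        _ = _ := by rw [setLIntegral_const, mul_comm]
    · rw [lintegral_lintegral_swap]
      · calc _ ≤ ∫⁻ y in B, 2 ^ finrank ℝ E * I ∂μ := by
              refine setLIntegral_mono' hBm fun x hx => ?_
              have := setLIntegral_comp_smul_add_le μ (s := 1 - t) (by linarith) (t • x) hBm
                (fun y hy => hBc hy hx (by linarith [ht.2]) ht.1 (by ring)) hHm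
              refine le_trans (le_of_eq ?_) this
              congr! 3
              module
          _ = _ := by rw [setLIntegral_const, mul_comm]
      · refine (Continuous.measurable ?_).aemeasurable
        exact hHc.comp (by fun_prop)
  calc _ ≤ ∫⁻ y in B, ∫⁻ x in B, (ENNReal.ofReal (2 * r) ^ 2 *
        ∫⁻ t in Set.Icc (0 : ℝ) 1, H (y + t • (x - y))) ∂μ ∂μ :=
        setLIntegral_mono' hBm fun y hy => setLIntegral_mono' hBm fun x hx => hpt y hy x hx
    _ = ENNReal.ofReal (2 * r) ^ 2 * ∫⁻ y in B, ∫⁻ x in B,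
        (∫⁻ t in Set.Icc (0 : ℝ) 1, H (y + t • (x - y))) ∂μ ∂μ := by
        have hc : ENNReal.ofReal (2 * r) ^ 2 ≠ ⊤ := by finiteness
        rw [← lintegral_const_mul' _ _ hc]
        simp_rw [← lintegral_const_mul' _ _ hc]
    _ = ENNReal.ofReal (2 * r) ^ 2 * ∫⁻ t in Set.Icc (0 : ℝ) 1, (∫⁻ y in B, ∫⁻ x in B,
        H (y + t • (x - y)) ∂μ ∂μ) := by
        congr 1
        symm
        rw [lintegral_lintegral_swap]
        · refine lintegral_congr fun y => ?_
          rw [lintegral_lintegral_swap]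
          exact (hHc.comp (by fun_prop :
            Continuous fun p : ℝ × E => y + p.1 • (p.2 - y))).measurable.aemeasurable
        · apply Measurable.aemeasurable
          apply Measurable.lintegral_prod_right' (f := fun q : (ℝ × E) × E =>
            H (q.1.2 + q.1.1 • (q.2 - q.1.2)))
          exact (hHc.comp (by fun_prop)).measurable
    _ ≤ ENNReal.ofReal (2 * r) ^ 2 * ∫⁻ t in Set.Icc (0 : ℝ) 1, μ B * (2 ^ finrank ℝ E * I) := by
        exact mul_le_mul' le_rfl (setLIntegral_mono' measurableSet_Icc ht)
    _ = _ := by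
        rw [setLIntegral_const, Real.volume_Icc]
        simp only [sub_zero, ENNReal.ofReal_one, mul_one]
        ring

open Module in
/-- Poincaré inequality on a ball. The value of `f` at a well-chosen point takes the place of the
average of `f`. -/
theorem exists_lintegral_ball_sub_sq_le [CompleteSpace F] {f : E → F} (hf : ContDiff ℝ 1 f)
    {r : ℝ} (hr : 0 < r) :
    ∃ c : F, ∫⁻ x in Metric.ball 0 r, ‖f x - c‖ₑ ^ 2 ∂μ ≤
      ENNReal.ofReal (2 * r) ^ 2 * 2 ^ finrank ℝ E *
        ∫⁻ x in Metric.ball 0 r, ‖fderiv ℝ f x‖ₑ ^ 2 ∂μ := by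
  have h0 : μ (Metric.ball (0 : E) r) ≠ 0 := (Metric.measure_ball_pos μ 0 hr).ne'
  have h1 : μ (Metric.ball (0 : E) r) ≠ ⊤ := measure_ball_lt_top.ne
  have hm : Measurable fun y => ∫⁻ x in Metric.ball 0 r, ‖f x - f y‖ₑ ^ 2 ∂μ := by
    apply Measurable.lintegral_prod_right' (f := fun q : E × E => ‖f q.2 - f q.1‖ₑ ^ 2)
    have := hf.continuous
    have h2 : Continuous fun q : E × E => ‖f q.2 - f q.1‖ₑ := by fun_prop
    exact h2.measurable.pow_const 2
  obtain ⟨y, -, hy⟩ := exists_le_setLAverage h0 h1 hm.aemeasurable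
  refine ⟨f y, hy.trans ?_⟩
  rw [setLAverage_eq]
  refine ENNReal.div_le_of_le_mul ((lintegral_lintegral_ball_sub_sq_le μ hf r).trans
    (le_of_eq ?_))
  ring

end ConversePoincare

/-! ### The converse weighted Poincaré inequality -/

section Outer

variable {E F : Type*} [NormedAddCommGroup E] [NormedSpace ℝ E] [NormedAddCommGroup F]
  [NormedSpace ℝ F] [FiniteDimensional ℝ E] [MeasurableSpace E] [BorelSpace E] (μ : Measure E)
  [μ.IsAddHaarMeasure]

open Module in
/-- A weight on `E` that, along every ray and outside the ball of radius `R`, decays at least like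
the power `1 - dim E` of the norm, over dilations by factors in `[1, 2]`. -/
def RadialDecay (w : E → ENNReal) (R : ℝ) : Prop :=
  ∀ x, R ≤ ‖x‖ → ∀ l ∈ Set.Icc (1 : ℝ) 2,
    ENNReal.ofReal l ^ finrank ℝ E * w (l • x) ≤ ENNReal.ofReal l * w x

theorem RadialDecay.lintegral_comp_smul_le {w : E → ENNReal} {R : ℝ} (hw : RadialDecay w R)
    (hwm : Measurable w) {l : ℝ} (hl : l ∈ Set.Icc (1 : ℝ) 2) {g : E → ENNReal}
    (hg : Measurable g) :
    ∫⁻ x in {x | 2 * R ≤ ‖x‖}, g (l⁻¹ • x) * w x ∂μ ≤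
      ENNReal.ofReal l * ∫⁻ x in {x | R ≤ ‖x‖}, g x * w x ∂μ := by
  have hl0 : 0 < l := by linarith [hl.1]
  have hS : ∀ r : ℝ, MeasurableSet {x : E | r ≤ ‖x‖} := fun r =>
    measurableSet_le measurable_const measurable_norm
  have hm : Measurable ({x : E | 2 * R ≤ ‖x‖}.indicator fun x => g (l⁻¹ • x) * w x) :=
    ((hg.comp (measurable_const_smul _)).mul hwm).indicator (hS _)
  have h := ofReal_pow_mul_lintegral_comp_smul_add μ hl0 0 hm
  rw [← lintegral_indicator (hS _), ← h, ← lintegral_const_mul' _ _ (by finiteness),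
    ← lintegral_const_mul' _ _ (by finiteness), ← lintegral_indicator (hS _)]
  refine lintegral_mono fun x => ?_
  by_cases hx : 2 * R ≤ ‖l • x‖
  · have hx' : R ≤ ‖x‖ := by
      rw [norm_smul, Real.norm_of_nonneg hl0.le] at hx
      nlinarith [norm_nonneg x, hl.2]
    simp only [add_zero, Set.indicator, Set.mem_ofPred_eq, hx, hx', if_true, smul_smul,
      inv_mul_cancel₀ hl0.ne', one_smul]
    rw [mul_left_comm, mul_left_comm _ (g x)]
    exact mul_le_mul' le_rfl (hw x hx' l hl)
  · simp [Set.indicator, hx]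

omit [NormedSpace ℝ F] in
theorem two_mul_enorm_sub_sq_le (a b c : F) :
    2 * ‖a - c‖ₑ ^ 2 ≤ 3 * ‖b - c‖ₑ ^ 2 + 6 * ‖a - b‖ₑ ^ 2 := by
  have h : 2 * ‖a - c‖₊ ^ 2 ≤ 3 * ‖b - c‖₊ ^ 2 + 6 * ‖a - b‖₊ ^ 2 := by
    rw [← NNReal.coe_le_coe]
    push_cast
    have h1 := norm_add_le (a - b) (b - c)
    rw [sub_add_sub_cancel] at h1
    have h2 : ‖a - c‖ ^ 2 ≤ (‖a - b‖ + ‖b - c‖) ^ 2 := by gcongr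
    nlinarith [sq_nonneg (‖b - c‖ - 2 * ‖a - b‖)]
  simp only [enorm_eq_nnnorm]
  exact_mod_cast h

/-- The increments of `f` between `x / 2` and `x`, at infinity. -/
theorem RadialDecay.lintegral_increment_le [CompleteSpace F] {w : E → ENNReal} {R : ℝ}
    (hw : RadialDecay w R) (hwm : Measurable w) {f : E → F} (hf : ContDiff ℝ 1 f) :
    4 * ∫⁻ x in {x | 2 * R ≤ ‖x‖},
        ‖f x - f ((2 : ℝ)⁻¹ • x)‖ₑ ^ 2 * (‖x‖ₑ ^ 2)⁻¹ * w x ∂μ ≤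
      2 * ∫⁻ x, ‖fderiv ℝ f x‖ₑ ^ 2 * w x ∂μ := by
  set S : Set E := {x | 2 * R ≤ ‖x‖}
  have hS : MeasurableSet S := measurableSet_le measurable_const measurable_norm
  set H : E → ENNReal := fun x => ‖fderiv ℝ f x‖ₑ ^ 2 with hH
  have hHm : Measurable H := (hf.continuous_fderiv one_ne_zero).enorm.measurable.pow_const 2
  set D := ∫⁻ x, H x * w x ∂μ
  have hpt : ∀ x : E, 4 * (‖f x - f ((2 : ℝ)⁻¹ • x)‖ₑ ^ 2 * (‖x‖ₑ ^ 2)⁻¹ * w x) ≤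
      ∫⁻ t in Set.Icc (0 : ℝ) 1, H (((1 + t) / 2) • x) * w x := fun x => by
    rw [lintegral_mul_const _ (show Measurable fun t : ℝ => H (((1 + t) / 2) • x) from
      hHm.comp (Continuous.measurable (by fun_prop))), ← mul_assoc, ← mul_assoc]
    refine mul_le_mul' ?_ le_rfl
    have h1 := enorm_sub_sq_le_lintegral_fderiv hf ((2 : ℝ)⁻¹ • x) x
    have h2 : ∀ t : ℝ, (2 : ℝ)⁻¹ • x + t • (x - (2 : ℝ)⁻¹ • x) = ((1 + t) / 2) • x := fun t => by
      module
    have h3 : 4 * ‖x - (2 : ℝ)⁻¹ • x‖ₑ ^ 2 = ‖x‖ₑ ^ 2 := by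
      have : x = (2 : ℝ) • (x - (2 : ℝ)⁻¹ • x) := by module
      conv_rhs => rw [this, enorm_smul, mul_pow]
      congr 1
      rw [← ofReal_norm, Real.norm_of_nonneg zero_le_two, ENNReal.ofReal_ofNat]
      norm_num
    simp only [h2] at h1
    calc 4 * ‖f x - f ((2 : ℝ)⁻¹ • x)‖ₑ ^ 2 * (‖x‖ₑ ^ 2)⁻¹
        ≤ 4 * (‖x - (2 : ℝ)⁻¹ • x‖ₑ ^ 2 *
          ∫⁻ t in Set.Icc (0 : ℝ) 1, H (((1 + t) / 2) • x)) * (‖x‖ₑ ^ 2)⁻¹ := by gcongr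
      _ = (‖x‖ₑ ^ 2 * (‖x‖ₑ ^ 2)⁻¹) * ∫⁻ t in Set.Icc (0 : ℝ) 1, H (((1 + t) / 2) • x) := by
        rw [← mul_assoc, h3]
        ring
      _ ≤ _ := mul_le_of_le_one_left' (ENNReal.mul_inv_le_one _)
  have ht : ∀ t ∈ Set.Icc (0 : ℝ) 1,
      ∫⁻ x in S, H (((1 + t) / 2) • x) * w x ∂μ ≤ 2 * D := fun t ht => by
    have hl : ((1 + t) / 2)⁻¹ ∈ Set.Icc (1 : ℝ) 2 := by
      constructor
      · exact (one_le_inv₀ (by linarith [ht.1])).2 (by linarith [ht.2])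
      · rw [inv_le_comm₀ (by linarith [ht.1]) two_pos]
        linarith [ht.1]
    have h := hw.lintegral_comp_smul_le μ hwm hl hHm
    rw [inv_inv] at h
    refine h.trans (mul_le_mul' ?_ (setLIntegral_le_lintegral _ _))
    rw [← ENNReal.ofReal_ofNat 2]
    exact ENNReal.ofReal_le_ofReal hl.2
  calc _ ≤ ∫⁻ x in S, (∫⁻ t in Set.Icc (0 : ℝ) 1, H (((1 + t) / 2) • x) * w x) ∂μ := by
        rw [← lintegral_const_mul' _ _ (by finiteness)]
        exact lintegral_mono hpt
    _ = ∫⁻ t in Set.Icc (0 : ℝ) 1, (∫⁻ x in S, H (((1 + t) / 2) • x) * w x ∂μ) := by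
        rw [lintegral_lintegral_swap]
        refine Measurable.aemeasurable (Measurable.mul (hHm.comp ?_) (hwm.comp measurable_fst))
        exact Continuous.measurable (by fun_prop)
    _ ≤ ∫⁻ t in Set.Icc (0 : ℝ) 1, 2 * D := setLIntegral_mono' measurableSet_Icc ht
    _ = _ := by simp

/-- A Hardy inequality at infinity: the decay of `w` makes the dilation by `1/2` a contraction for
the weight `‖x‖⁻² w`, so that the integral at infinity on the left can be absorbed. -/
theorem RadialDecay.lintegral_outside_le [CompleteSpace F] {w : E → ENNReal} {R : ℝ} (hR : 0 < R)
    (hw : RadialDecay w R) (hwm : Measurable w) {f : E → F} (hf : ContDiff ℝ 1 f) (c : F)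
    (hfin : ∫⁻ x, ‖f x - c‖ₑ ^ 2 * w x ∂μ ≠ ⊤) :
    ∫⁻ x in {x | 2 * R ≤ ‖x‖}, ‖f x - c‖ₑ ^ 2 * (‖x‖ₑ ^ 2)⁻¹ * w x ∂μ ≤
      3 * ((ENNReal.ofReal R ^ 2)⁻¹ *
        ∫⁻ x in Metric.ball 0 (2 * R), ‖f x - c‖ₑ ^ 2 * w x ∂μ) +
      6 * ∫⁻ x, ‖fderiv ℝ f x‖ₑ ^ 2 * w x ∂μ := by
  have hS : ∀ r : ℝ, MeasurableSet {x : E | r ≤ ‖x‖} := fun r =>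
    measurableSet_le measurable_const measurable_norm
  set S : Set E := {x | 2 * R ≤ ‖x‖}
  set D := ∫⁻ x, ‖fderiv ℝ f x‖ₑ ^ 2 * w x ∂μ
  set P := ∫⁻ x in Metric.ball 0 (2 * R), ‖f x - c‖ₑ ^ 2 * w x ∂μ
  set N : E → ENNReal := fun x => ‖f x - c‖ₑ ^ 2 * (‖x‖ₑ ^ 2)⁻¹ with hN
  have hfc := hf.continuous
  have hNm : Measurable N :=
    ((show Continuous fun x => ‖f x - c‖ₑ by fun_prop).measurable.pow_const 2).mul
      ((measurable_enorm.pow_const 2).inv)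
  set A := ∫⁻ x in S, N x * w x ∂μ
  have hbound : ∀ x : E, R ≤ ‖x‖ → N x * w x ≤
      (ENNReal.ofReal R ^ 2)⁻¹ * (‖f x - c‖ₑ ^ 2 * w x) := fun x hx => by
    simp only [hN]
    rw [mul_comm (‖f x - c‖ₑ ^ 2) (‖x‖ₑ ^ 2)⁻¹, mul_assoc]
    gcongr
    rw [← ofReal_norm]
    exact ENNReal.ofReal_le_ofReal hx
  have hRinv : (ENNReal.ofReal R ^ 2)⁻¹ ≠ ⊤ := by simp [hR]
  have hA : A ≠ ⊤ := by
    refine ne_top_of_le_ne_top (ENNReal.mul_ne_top hRinv hfin) ?_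
    rw [← lintegral_const_mul' _ _ hRinv]
    exact (setLIntegral_mono' (hS _) fun x hx => hbound x (by linarith [hx.out])).trans
      (setLIntegral_le_lintegral _ _)
  have hS1 : ∫⁻ x in {x | R ≤ ‖x‖}, N x * w x ∂μ ≤ A + (ENNReal.ofReal R ^ 2)⁻¹ * P := by
    have hsub : {x : E | R ≤ ‖x‖} ⊆ S ∪ ({x | R ≤ ‖x‖} ∩ Metric.ball 0 (2 * R)) := by
      intro x hx
      by_cases h : 2 * R ≤ ‖x‖
      · exact Or.inl h
      · exact Or.inr ⟨hx, by simpa using h⟩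
    refine (lintegral_mono_set hsub).trans ((lintegral_union_le _ _ _).trans ?_)
    gcongr
    rw [← lintegral_const_mul' _ _ hRinv]
    exact (setLIntegral_mono' ((hS _).inter measurableSet_ball) fun x hx => hbound x hx.1).trans
      (lintegral_mono_set Set.inter_subset_right)
  have hT1 : 2 * ∫⁻ x in S, ‖f ((2 : ℝ)⁻¹ • x) - c‖ₑ ^ 2 * (‖x‖ₑ ^ 2)⁻¹ * w x ∂μ ≤
      ∫⁻ x in {x | R ≤ ‖x‖}, N x * w x ∂μ := by
    have h := hw.lintegral_comp_smul_le μ hwm (l := 2) (by norm_num) hNm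
    have h4 : ∀ x : E, N ((2 : ℝ)⁻¹ • x) * w x =
        4 * (‖f ((2 : ℝ)⁻¹ • x) - c‖ₑ ^ 2 * (‖x‖ₑ ^ 2)⁻¹ * w x) := fun x => by
      have h5 : (‖(2 : ℝ)⁻¹ • x‖ₑ ^ 2)⁻¹ = 4 * (‖x‖ₑ ^ 2)⁻¹ := by
        rw [enorm_smul, mul_pow, ENNReal.mul_inv (by simp) (by simp)]
        congr 1
        rw [← ofReal_norm, Real.norm_of_nonneg (by norm_num), ENNReal.ofReal_inv_of_pos two_pos,
          ENNReal.ofReal_ofNat, ENNReal.inv_pow, inv_inv]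
        norm_num
      simp only [hN, h5]
      ring
    simp only [h4] at h
    rw [lintegral_const_mul' _ _ (by finiteness), ENNReal.ofReal_ofNat,
      show (4 : ENNReal) = 2 * 2 by norm_num, mul_assoc] at h
    exact (ENNReal.mul_le_mul_iff_right two_ne_zero ENNReal.ofNat_ne_top).1 h
  have hT2 := hw.lintegral_increment_le μ hwm hf
  set T1 := ∫⁻ x in S, ‖f ((2 : ℝ)⁻¹ • x) - c‖ₑ ^ 2 * (‖x‖ₑ ^ 2)⁻¹ * w x ∂μ
  set T2 := ∫⁻ x in S, ‖f x - f ((2 : ℝ)⁻¹ • x)‖ₑ ^ 2 * (‖x‖ₑ ^ 2)⁻¹ * w x ∂μ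
  have hsplit : 2 * A ≤ 3 * T1 + 6 * T2 := by
    have hm : Measurable fun x => 3 * (‖f ((2 : ℝ)⁻¹ • x) - c‖ₑ ^ 2 * (‖x‖ₑ ^ 2)⁻¹ * w x) :=
      (((((show Continuous fun x => ‖f ((2 : ℝ)⁻¹ • x) - c‖ₑ by fun_prop).measurable.pow_const
        2).mul ((measurable_enorm.pow_const 2).inv)).mul hwm)).const_mul 3
    rw [← lintegral_const_mul' _ _ (by finiteness), ← lintegral_const_mul' _ _ (by finiteness),
      ← lintegral_const_mul' _ _ (by finiteness), ← lintegral_add_left hm]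
    refine lintegral_mono fun x => ?_
    have := two_mul_enorm_sub_sq_le (f x) (f ((2 : ℝ)⁻¹ • x)) c
    calc 2 * (N x * w x) = 2 * ‖f x - c‖ₑ ^ 2 * ((‖x‖ₑ ^ 2)⁻¹ * w x) := by simp only [hN]; ring
      _ ≤ (3 * ‖f ((2 : ℝ)⁻¹ • x) - c‖ₑ ^ 2 + 6 * ‖f x - f ((2 : ℝ)⁻¹ • x)‖ₑ ^ 2) *
          ((‖x‖ₑ ^ 2)⁻¹ * w x) := by gcongr
      _ = _ := by ring
  have hfour : 4 * A ≤ 3 * A + (3 * ((ENNReal.ofReal R ^ 2)⁻¹ * P) + 6 * D) := by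
    calc 4 * A = 2 * (2 * A) := by ring
      _ ≤ 2 * (3 * T1 + 6 * T2) := by gcongr
      _ = 3 * (2 * T1) + 3 * (4 * T2) := by ring
      _ ≤ 3 * (A + (ENNReal.ofReal R ^ 2)⁻¹ * P) + 3 * (2 * D) := by
        gcongr
        exact hT1.trans hS1
      _ = _ := by ring
  rw [show (4 : ENNReal) * A = 3 * A + A by ring] at hfour
  exact (ENNReal.add_le_add_iff_left (ENNReal.mul_ne_top (by simp) hA)).1 hfour

/-- The converse weighted Poincaré inequality. -/
theorem exists_lintegral_sub_sq_le [CompleteSpace F] {w : E → ENNReal} {R : ℝ} (hR : 0 < R)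
    (hw : RadialDecay w R) (hwm : Measurable w) (hwfin : ∫⁻ x, w x ∂μ ≠ ⊤) {b κ : ENNReal}
    (hκ : κ ≠ ⊤) (hwb : ∀ x ∈ Metric.ball 0 (2 * R), w x ≤ b ∧ b ≤ κ * w x) :
    ∃ K : ENNReal, K ≠ ⊤ ∧ ∀ f : E → F, ContDiff ℝ 1 f → ∫⁻ x, ‖f x‖ₑ ^ 2 * w x ∂μ ≠ ⊤ →
      ∃ c, ∫⁻ x, ‖f x - c‖ₑ ^ 2 * (1 + ‖x‖ₑ ^ 2)⁻¹ * w x ∂μ ≤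
        K * ∫⁻ x, ‖fderiv ℝ f x‖ₑ ^ 2 * w x ∂μ := by
  set C := ENNReal.ofReal (2 * (2 * R)) ^ 2 * 2 ^ Module.finrank ℝ E
  have hRinv : (ENNReal.ofReal R ^ 2)⁻¹ ≠ ⊤ := by simp [hR]
  refine ⟨C * κ + (3 * ((ENNReal.ofReal R ^ 2)⁻¹ * (C * κ)) + 6), by finiteness, fun f hf hf2 => ?_⟩
  obtain ⟨c, hc⟩ := exists_lintegral_ball_sub_sq_le μ hf (r := 2 * R) (by positivity)
  refine ⟨c, ?_⟩
  have hfc := hf.continuous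
  have hfin : ∫⁻ x, ‖f x - c‖ₑ ^ 2 * w x ∂μ ≠ ⊤ := by
    refine ne_top_of_le_ne_top
      (b := 3 * ∫⁻ x, ‖f x‖ₑ ^ 2 * w x ∂μ + 6 * (‖c‖ₑ ^ 2 * ∫⁻ x, w x ∂μ)) (by finiteness) ?_
    rw [← lintegral_const_mul' _ _ (by finiteness), ← lintegral_const_mul' _ _ (by finiteness),
      ← lintegral_const_mul' _ _ (by finiteness), ← lintegral_add_right _ (by fun_prop)]
    refine lintegral_mono fun x => ?_
    have := two_mul_enorm_sub_sq_le c 0 (f x)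
    rw [zero_sub, enorm_neg, sub_zero, ← neg_sub, enorm_neg] at this
    calc ‖f x - c‖ₑ ^ 2 * w x ≤ 2 * ‖f x - c‖ₑ ^ 2 * w x := by
          gcongr
          exact le_mul_of_one_le_left' one_le_two
      _ ≤ (3 * ‖f x‖ₑ ^ 2 + 6 * ‖c‖ₑ ^ 2) * w x := by gcongr
      _ = _ := by ring
  set B : Set E := Metric.ball 0 (2 * R)
  have hBm : MeasurableSet B := measurableSet_ball
  set D := ∫⁻ x, ‖fderiv ℝ f x‖ₑ ^ 2 * w x ∂μ
  have hfm : Measurable fun x => ‖f x - c‖ₑ ^ 2 :=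
    (show Continuous fun x => ‖f x - c‖ₑ by fun_prop).measurable.pow_const 2
  have hHm : Measurable fun x => ‖fderiv ℝ f x‖ₑ ^ 2 :=
    (hf.continuous_fderiv one_ne_zero).enorm.measurable.pow_const 2
  have hP : ∫⁻ x in B, ‖f x - c‖ₑ ^ 2 * w x ∂μ ≤ C * κ * D := by
    calc ∫⁻ x in B, ‖f x - c‖ₑ ^ 2 * w x ∂μ ≤ ∫⁻ x in B, ‖f x - c‖ₑ ^ 2 * b ∂μ :=
          setLIntegral_mono' hBm fun x hx => mul_le_mul' le_rfl (hwb x hx).1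
      _ ≤ C * (∫⁻ x in B, ‖fderiv ℝ f x‖ₑ ^ 2 ∂μ) * b := by
          rw [lintegral_mul_const _ hfm]
          gcongr
      _ = C * ∫⁻ x in B, ‖fderiv ℝ f x‖ₑ ^ 2 * b ∂μ := by
          rw [lintegral_mul_const _ hHm, mul_assoc]
      _ ≤ C * ∫⁻ x in B, κ * (‖fderiv ℝ f x‖ₑ ^ 2 * w x) ∂μ := by
          refine mul_le_mul' le_rfl (setLIntegral_mono' hBm fun x hx => ?_)
          rw [mul_left_comm]
          exact mul_le_mul' le_rfl (hwb x hx).2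
      _ ≤ C * κ * D := by
          rw [lintegral_const_mul' _ _ hκ, ← mul_assoc]
          exact mul_le_mul' le_rfl (setLIntegral_le_lintegral _ _)
  have hBc : Bᶜ = {x | 2 * R ≤ ‖x‖} := by
    ext x
    simp [B]
  rw [← lintegral_add_compl _ hBm, add_mul]
  refine add_le_add (le_trans (lintegral_mono fun x => ?_) hP) ?_
  · gcongr
    exact mul_le_of_le_one_right' (ENNReal.inv_le_one.2 le_self_add)
  · rw [hBc]
    refine le_trans (lintegral_mono fun x => ?_)
      ((hw.lintegral_outside_le μ hR hwm hf c hfin).trans ?_)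
    · gcongr
      exact le_add_self
    · calc _ ≤ 3 * ((ENNReal.ofReal R ^ 2)⁻¹ * (C * κ * D)) + 6 * D := by gcongr
        _ = _ := by ring

end Outer

/-! ### Existence of Stein kernels from a bound by the gradient -/

section Riesz

theorem MeasureTheory.MemLp.inner_toLp_eq_integral {α H : Type*} [MeasurableSpace α]
    {ν : Measure α} [NormedAddCommGroup H] [InnerProductSpace ℝ H] {a b : α → H}
    (ha : MemLp a 2 ν) (hb : MemLp b 2 ν) :
    inner ℝ (ha.toLp a) (hb.toLp b) = ∫ x, inner ℝ (a x) (b x) ∂ν := by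
  rw [L2.inner_def]
  refine integral_congr_ae ?_
  filter_upwards [ha.coeFn_toLp, hb.coeFn_toLp] with x h1 h2
  rw [h1, h2]

theorem MeasureTheory.MemLp.norm_toLp_eq_sqrt {α H : Type*} [MeasurableSpace α]
    {ν : Measure α} [NormedAddCommGroup H] [InnerProductSpace ℝ H] {a : α → H}
    (ha : MemLp a 2 ν) : ‖ha.toLp a‖ = √(∫ x, ‖a x‖ ^ 2 ∂ν) := by
  rw [norm_eq_sqrt_real_inner, ha.inner_toLp_eq_integral ha]
  simp

theorem MeasureTheory.MemLp.integrable_real_inner {α H : Type*} [MeasurableSpace α]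
    {ν : Measure α} [NormedAddCommGroup H] [InnerProductSpace ℝ H] {a b : α → H}
    (ha : MemLp a 2 ν) (hb : MemLp b 2 ν) : Integrable (fun x => inner ℝ (a x) (b x)) ν := by
  refine (L2.integrable_inner (𝕜 := ℝ) (ha.toLp a) (hb.toLp b)).congr ?_
  filter_upwards [ha.coeFn_toLp, hb.coeFn_toLp] with x h1 h2
  rw [h1, h2]

theorem MeasureTheory.MemLp.abs_integral_inner_le {α H : Type*} [MeasurableSpace α]
    {ν : Measure α} [NormedAddCommGroup H] [InnerProductSpace ℝ H] {a b : α → H}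
    (ha : MemLp a 2 ν) (hb : MemLp b 2 ν) :
    |∫ x, inner ℝ (a x) (b x) ∂ν| ≤ √(∫ x, ‖a x‖ ^ 2 ∂ν) * √(∫ x, ‖b x‖ ^ 2 ∂ν) := by
  rw [← ha.inner_toLp_eq_integral hb, ← ha.norm_toLp_eq_sqrt, ← hb.norm_toLp_eq_sqrt]
  exact abs_real_inner_le_norm _ _

/-- A linear functional dominated by the norm of `T` is represented by a vector, through `T`. -/
theorem LinearMap.exists_inner_eq_of_le_norm {A H : Type*} [AddCommGroup A] [Module ℝ A]
    [NormedAddCommGroup H] [InnerProductSpace ℝ H] [CompleteSpace H] (T : A →ₗ[ℝ] H)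
    (l : A →ₗ[ℝ] ℝ) (C : ℝ) (h : ∀ u, |l u| ≤ C * ‖T u‖) :
    ∃ v : H, ∀ u, l u = inner ℝ v (T u) := by
  obtain ⟨s, hs⟩ := T.rangeRestrict.exists_rightInverse_of_surjective
    (LinearMap.range_rangeRestrict T)
  have hs' : ∀ y, T (s y) = y := fun y => congrArg Subtype.val (LinearMap.congr_fun hs y)
  let g : StrongDual ℝ (LinearMap.range T) := (l ∘ₗ s).mkContinuous C fun y => by
    have := h (s y)
    rw [hs'] at this
    exact this
  obtain ⟨G, hG, -⟩ := exists_extension_norm_eq (LinearMap.range T) g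
  refine ⟨(InnerProductSpace.toDual ℝ H).symm G, fun u => ?_⟩
  rw [InnerProductSpace.toDual_symm_apply, hG ⟨T u, LinearMap.mem_range_self T u⟩]
  have h0 := h (s ⟨T u, LinearMap.mem_range_self T u⟩ - u)
  rw [map_sub T, hs', sub_self, norm_zero, mul_zero, abs_nonpos_iff, map_sub, sub_eq_zero] at h0
  exact h0.symm

end Riesz

namespace SteinKernel

section Existence

variable {d : ℕ}

/-- A matrix as a vector of `ℝ^(d × d)`, whose Euclidean norm is the Hilbert–Schmidt norm. -/
def hsVec : Matrix (Fin d) (Fin d) ℝ →ₗ[ℝ] EuclideanSpace ℝ (Fin d × Fin d) where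
  toFun A := WithLp.toLp 2 fun q => A q.1 q.2
  map_add' _ _ := rfl
  map_smul' _ _ := rfl

@[simp] theorem hsVec_apply (A : Matrix (Fin d) (Fin d) ℝ) (q : Fin d × Fin d) :
    hsVec A q = A q.1 q.2 := rfl

theorem hsInner_eq_inner (A B : Matrix (Fin d) (Fin d) ℝ) :
    hsInner A B = inner ℝ (hsVec A) (hsVec B) := by
  simp only [hsInner, PiLp.inner_apply, hsVec_apply, Fintype.sum_prod_type]
  simp [mul_comm]

theorem hsInner_self (A : Matrix (Fin d) (Fin d) ℝ) : hsInner A A = ‖hsVec A‖ ^ 2 := by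
  rw [hsInner_eq_inner, real_inner_self_eq_norm_sq]

theorem matrixMemL2_iff {ν : Measure (EuclideanSpace ℝ (Fin d))}
    {F : EuclideanSpace ℝ (Fin d) → Matrix (Fin d) (Fin d) ℝ} :
    MatrixMemL2 ν F ↔ MemLp (fun x => hsVec (F x)) 2 ν := by
  rw [memLp_piLp_iff, Prod.forall]
  rfl

theorem norm_fderiv_le_norm_hsVec_grad
    (u : EuclideanSpace ℝ (Fin d) → EuclideanSpace ℝ (Fin d)) (x : EuclideanSpace ℝ (Fin d)) :
    ‖fderiv ℝ u x‖ ≤ ‖hsVec (grad u x)‖ := by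
  refine ContinuousLinearMap.opNorm_le_bound _ (norm_nonneg _) fun v => ?_
  refine le_of_sq_le_sq ?_ (by positivity)
  rw [mul_pow, ← hsInner_self, EuclideanSpace.real_norm_sq_eq, EuclideanSpace.real_norm_sq_eq,
    hsInner, Finset.sum_mul]
  refine Finset.sum_le_sum fun i _ => ?_
  have hv : fderiv ℝ u x v i = ∑ j, grad u x i j * v j := by
    conv_lhs => rw [← (EuclideanSpace.basisFun (Fin d) ℝ).sum_repr v]
    simp [grad, mul_comm]
  rw [hv]
  refine (Finset.sum_mul_sq_le_sq_mul_sq _ _ _).trans (le_of_eq ?_)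
  simp [sq]

theorem grad_add {u v : EuclideanSpace ℝ (Fin d) → EuclideanSpace ℝ (Fin d)}
    (hu : Differentiable ℝ u) (hv : Differentiable ℝ v) (x : EuclideanSpace ℝ (Fin d)) :
    grad (u + v) x = grad u x + grad v x := by
  ext i j
  simp [grad, fderiv_add (hu x) (hv x)]

theorem grad_const_smul {u : EuclideanSpace ℝ (Fin d) → EuclideanSpace ℝ (Fin d)} (c : ℝ)
    (x : EuclideanSpace ℝ (Fin d)) : grad (c • u) x = c • grad u x := by
  ext i j
  simp [grad, fderiv_const_smul_field]

/-- The smooth vector fields `u` with `u, ∇u ∈ L²(ν)`. -/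
def smoothSobolev (ν : Measure (EuclideanSpace ℝ (Fin d))) :
    Submodule ℝ (EuclideanSpace ℝ (Fin d) → EuclideanSpace ℝ (Fin d)) where
  carrier := {u | ContDiff ℝ (⊤ : ℕ∞) u ∧ MemLp u 2 ν ∧ MatrixMemL2 ν (grad u)}
  add_mem' := by
    rintro u v ⟨hu, hu2, hug⟩ ⟨hv, hv2, hvg⟩
    refine ⟨hu.add hv, hu2.add hv2, matrixMemL2_iff.2 ?_⟩
    simp_rw [grad_add (hu.differentiable (by simp)) (hv.differentiable (by simp)), map_add]
    exact (matrixMemL2_iff.1 hug).add (matrixMemL2_iff.1 hvg)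
  zero_mem' := by
    refine ⟨contDiff_const, MemLp.zero, matrixMemL2_iff.2 ?_⟩
    have h : ∀ x, grad (0 : EuclideanSpace ℝ (Fin d) → EuclideanSpace ℝ (Fin d)) x = 0 :=
      fun x => by simpa using grad_const_smul (u := 0) 0 x
    simp [h]
  smul_mem' := by
    rintro c u ⟨hu, hu2, hug⟩
    refine ⟨hu.const_smul c, hu2.const_smul c, matrixMemL2_iff.2 ?_⟩
    simp_rw [grad_const_smul, map_smul]
    exact (matrixMemL2_iff.1 hug).const_smul c

/-- If `u ↦ ∫ x · u dν` is bounded by the `L²(ν)` norm of `∇u` over smooth `u`, the Riesz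
representation theorem provides a Stein kernel. -/
theorem exists_isSteinKernel_of_le {ν : Measure (EuclideanSpace ℝ (Fin d))}
    (hx : MemLp (fun x : EuclideanSpace ℝ (Fin d) => x) 2 ν) (C : ℝ)
    (hC : ∀ u : EuclideanSpace ℝ (Fin d) → EuclideanSpace ℝ (Fin d),
      ContDiff ℝ (⊤ : ℕ∞) u → MemLp u 2 ν → MatrixMemL2 ν (grad u) →
      |∫ x, inner ℝ x (u x) ∂ν| ≤ C * √(∫ x, ‖hsVec (grad u x)‖ ^ 2 ∂ν)) :
    ∃ τ, IsSteinKernel ν τ := by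
  let T : smoothSobolev ν →ₗ[ℝ] Lp (EuclideanSpace ℝ (Fin d × Fin d)) 2 ν :=
    { toFun := fun u => (matrixMemL2_iff.1 u.2.2.2).toLp _
      map_add' := fun u v => by
        rw [← MemLp.toLp_add]
        refine MemLp.toLp_congr _ _ (Eventually.of_forall fun x => ?_)
        simp [grad_add (u.2.1.differentiable (by simp)) (v.2.1.differentiable (by simp))]
      map_smul' := fun c u => by
        rw [RingHom.id_apply, ← MemLp.toLp_const_smul]
        refine MemLp.toLp_congr _ _ (Eventually.of_forall fun x => ?_)
        simp [grad_const_smul] }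
  let l : smoothSobolev ν →ₗ[ℝ] ℝ :=
    { toFun := fun u => ∫ x, inner ℝ x (u.1 x) ∂ν
      map_add' := fun u v => by
        rw [← integral_add (hx.integrable_real_inner u.2.2.1) (hx.integrable_real_inner v.2.2.1)]
        simp [inner_add_right]
      map_smul' := fun c u => by
        simp [inner_smul_right, integral_const_mul] }
  obtain ⟨t, ht⟩ := T.exists_inner_eq_of_le_norm l C fun u =>
    (hC u u.2.1 u.2.2.1 u.2.2.2).trans_eq (by
      rw [← (matrixMemL2_iff.1 u.2.2.2).norm_toLp_eq_sqrt]
      rfl)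
  let τ : EuclideanSpace ℝ (Fin d) → Matrix (Fin d) (Fin d) ℝ := fun x =>
    Matrix.of fun i j => t x (i, j)
  have hτv : ∀ x, hsVec (τ x) = t x := fun x => rfl
  have hτ : MemLp (fun x => hsVec (τ x)) 2 ν := by
    simp only [hτv]
    exact Lp.memLp t
  have hsmooth : ∀ u : EuclideanSpace ℝ (Fin d) → EuclideanSpace ℝ (Fin d),
      ContDiff ℝ (⊤ : ℕ∞) u → MemLp u 2 ν → MatrixMemL2 ν (grad u) →
      ∫ x, inner ℝ x (u x) ∂ν = ∫ x, inner ℝ (hsVec (τ x)) (hsVec (grad u x)) ∂ν := by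
    intro u h1 h2 h3
    have h := ht ⟨u, h1, h2, h3⟩
    rw [← hτ.inner_toLp_eq_integral (matrixMemL2_iff.1 h3)]
    have h4 : hτ.toLp _ = t := by
      simp only [hτv]
      exact Lp.toLp_coeFn t _
    rw [h4]
    exact h
  refine ⟨τ, ⟨matrixMemL2_iff.2 hτ, fun φ G h => hx.integrable_real_inner h.memLp, fun φ G h => ?_,
    fun φ G h => ?_⟩⟩
  · simp_rw [hsInner_eq_inner]
    exact hτ.integrable_real_inner (matrixMemL2_iff.1 h.memLp_grad)
  · obtain ⟨u, hu, hu2, hug, hlim⟩ := h.exists_approx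
    have hG := matrixMemL2_iff.1 h.memLp_grad
    simp_rw [hsInner_eq_inner]
    set M : ℝ := √(∫ x, ‖x‖ ^ 2 ∂ν) + √(∫ x, ‖hsVec (τ x)‖ ^ 2 ∂ν)
    have hbound : ∀ n, |(∫ x, inner ℝ x (φ x) ∂ν) -
        ∫ x, inner ℝ (hsVec (τ x)) (hsVec (G x)) ∂ν| ≤
        M * √(sobolevNormSq ν (fun x => u n x - φ x) (fun x => grad (u n) x - G x)) := by
      intro n
      have hgn := matrixMemL2_iff.1 (hug n)
      have h1 := hx.abs_integral_inner_le ((hu2 n).sub h.memLp)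
      have h2 := hτ.abs_integral_inner_le (hgn.sub hG)
      simp only [Pi.sub_apply, inner_sub_right] at h1 h2
      rw [integral_sub (hx.integrable_real_inner (hu2 n)) (hx.integrable_real_inner h.memLp)] at h1
      rw [integral_sub (hτ.integrable_real_inner hgn) (hτ.integrable_real_inner hG),
        ← hsmooth (u n) (hu n) (hu2 n) (hug n)] at h2
      have i1 := ((hu2 n).sub h.memLp).integrable_norm_pow two_ne_zero
      have i2 := (hgn.sub hG).integrable_norm_pow two_ne_zero
      simp only [Pi.sub_apply] at i1 i2
      have hsum : sobolevNormSq ν (fun x => u n x - φ x) (fun x => grad (u n) x - G x) =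
          (∫ x, ‖u n x - φ x‖ ^ 2 ∂ν) +
            ∫ x, ‖hsVec (grad (u n) x) - hsVec (G x)‖ ^ 2 ∂ν := by
        rw [sobolevNormSq, ← integral_add i1 i2]
        simp_rw [hsInner_self, map_sub]
      have p1 : 0 ≤ ∫ x, ‖u n x - φ x‖ ^ 2 ∂ν := integral_nonneg fun x => by positivity
      have p2 : 0 ≤ ∫ x, ‖hsVec (grad (u n) x) - hsVec (G x)‖ ^ 2 ∂ν :=
        integral_nonneg fun x => by positivity
      rw [hsum, add_mul]
      have h1' := h1.trans (mul_le_mul_of_nonneg_left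
        (Real.sqrt_le_sqrt (le_add_of_nonneg_right p2)) (Real.sqrt_nonneg _))
      have h2' := h2.trans (mul_le_mul_of_nonneg_left
        (Real.sqrt_le_sqrt (le_add_of_nonneg_left p1)) (Real.sqrt_nonneg _))
      rw [abs_sub_comm] at h1'
      refine le_trans ?_ (add_le_add h1' h2')
      exact abs_sub_le _ _ _
    have hz : Tendsto (fun n => M * √(sobolevNormSq ν (fun x => u n x - φ x)
        (fun x => grad (u n) x - G x))) atTop (𝓝 0) := by
      simpa using (hlim.sqrt.const_mul M)
    have := ge_of_tendsto' hz hbound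
    exact sub_eq_zero.1 (abs_nonpos_iff.1 this)

open Module in
/-- The hypotheses on the density give the converse weighted Poincaré inequality; the mean being
zero, `u` may be replaced by `u - c` in `∫ x · u dν`. -/
theorem exists_isSteinKernel_withDensity {ρ : EuclideanSpace ℝ (Fin d) → ℝ} (hρ : Continuous ρ)
    (hpos : ∀ x, 0 < ρ x) {R : ℝ} (hR : 0 < R)
    (hdecay : ∀ x, R ≤ ‖x‖ → ∀ l ∈ Set.Icc (1 : ℝ) 2, l ^ d * ρ (l • x) ≤ l * ρ x)
    {ν : Measure (EuclideanSpace ℝ (Fin d))} [IsProbabilityMeasure ν]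
    (hν : ν = volume.withDensity fun x => ENNReal.ofReal (ρ x))
    (hmom : Integrable (fun x => ‖x‖ ^ 4) ν) (hmean : ∫ x, x ∂ν = 0) :
    ∃ τ, IsSteinKernel ν τ := by
  set w : EuclideanSpace ℝ (Fin d) → ENNReal := fun x => ENNReal.ofReal (ρ x) with hw
  have hwm : Measurable w := hρ.measurable.ennreal_ofReal
  have hlint : ∀ g : EuclideanSpace ℝ (Fin d) → ENNReal, Measurable g →
      ∫⁻ x, g x ∂ν = ∫⁻ x, g x * w x := fun g hg => by
    rw [hν, lintegral_withDensity_eq_lintegral_mul _ hwm hg]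
    simp [mul_comm]
  have hwdecay : RadialDecay w R := fun x hx l hl => by
    have hl0 : 0 ≤ l := by linarith [hl.1]
    rw [finrank_euclideanSpace_fin, ← ENNReal.ofReal_pow hl0,
      ← ENNReal.ofReal_mul (by positivity), ← ENNReal.ofReal_mul hl0]
    exact ENNReal.ofReal_le_ofReal (hdecay x hx l hl)
  have hwfin : ∫⁻ x, w x ≠ ⊤ := by
    have := hlint (fun _ => 1) measurable_const
    simp only [lintegral_const, measure_univ, one_mul] at this
    simp [← this]
  obtain ⟨b, κ, hκ, hwb⟩ : ∃ b κ : ENNReal, κ ≠ ⊤ ∧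
      ∀ x ∈ Metric.ball 0 (2 * R), w x ≤ b ∧ b ≤ κ * w x := by
    have hK := isCompact_closedBall (0 : EuclideanSpace ℝ (Fin d)) (2 * R)
    have hne : (Metric.closedBall (0 : EuclideanSpace ℝ (Fin d)) (2 * R)).Nonempty :=
      ⟨0, by simp [hR.le]⟩
    obtain ⟨x₁, -, h₁⟩ := hK.exists_isMinOn hne hρ.continuousOn
    obtain ⟨x₂, -, h₂⟩ := hK.exists_isMaxOn hne hρ.continuousOn
    refine ⟨w x₂, ENNReal.ofReal (ρ x₂ / ρ x₁), ENNReal.ofReal_ne_top, fun x hx => ?_⟩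
    have hx' := Metric.ball_subset_closedBall hx
    refine ⟨ENNReal.ofReal_le_ofReal (h₂ hx'), ?_⟩
    rw [hw, ← ENNReal.ofReal_mul (div_pos (hpos _) (hpos _)).le]
    refine ENNReal.ofReal_le_ofReal ?_
    rw [div_mul_eq_mul_div, le_div_iff₀ (hpos _)]
    exact mul_le_mul_of_nonneg_left (h₁ hx') (hpos _).le
  obtain ⟨K, hK, hpoin⟩ := exists_lintegral_sub_sq_le
    (F := EuclideanSpace ℝ (Fin d)) volume hR hwdecay hwm hwfin hκ hwb
  have hx : MemLp (fun x : EuclideanSpace ℝ (Fin d) => x) 2 ν := by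
    rw [memLp_two_iff_integrable_sq_norm (by fun_prop)]
    refine ((integrable_const (1 : ℝ)).add hmom).mono' (by fun_prop) (Eventually.of_forall fun x => ?_)
    rw [Real.norm_of_nonneg (by positivity)]
    simp only [Pi.add_apply]
    nlinarith [sq_nonneg (‖x‖ ^ 2 - 1)]
  -- The weight `1 + ‖x‖²` and its inverse are distributed over the two factors of `x · (u - c)`.
  have ha : MemLp (fun x : EuclideanSpace ℝ (Fin d) => √(1 + ‖x‖ ^ 2) • x) 2 ν := by
    rw [memLp_two_iff_integrable_sq_norm (by fun_prop)]
    refine ((integrable_const (1 : ℝ)).add (hmom.const_mul 2)).mono' (by fun_prop) (Eventually.of_forall fun x => ?_)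
    rw [Real.norm_of_nonneg (by positivity), norm_smul, mul_pow, Real.norm_eq_abs, sq_abs,
      Real.sq_sqrt (by positivity)]
    simp only [Pi.add_apply]
    nlinarith [sq_nonneg (‖x‖ ^ 2 - 1)]
  refine exists_isSteinKernel_of_le hx
    (√(∫ x, ‖√(1 + ‖x‖ ^ 2) • x‖ ^ 2 ∂ν) * √K.toReal) fun u hu hu2 hug => ?_
  have hgrad := matrixMemL2_iff.1 hug
  have hu1 : ContDiff ℝ 1 u := hu.of_le (by simp)
  have huc := hu.continuous
  obtain ⟨c, hc⟩ := hpoin u hu1 (by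
    rw [← hlint _ (huc.enorm.measurable.pow_const 2)]
    have h := (memLp_two_iff_integrable_sq_norm huc.aestronglyMeasurable).1 hu2
    have h2 := h.hasFiniteIntegral.ne
    simpa using h2)
  have huc2 : MemLp (fun x => u x - c) 2 ν := hu2.sub (memLp_const c)
  have hs : ∀ x : EuclideanSpace ℝ (Fin d), 0 < √(1 + ‖x‖ ^ 2) := fun x =>
    Real.sqrt_pos.2 (by positivity)
  have hbc : Continuous fun x : EuclideanSpace ℝ (Fin d) => (√(1 + ‖x‖ ^ 2))⁻¹ • (u x - c) := by
    have : Continuous fun x : EuclideanSpace ℝ (Fin d) => (√(1 + ‖x‖ ^ 2))⁻¹ :=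
      Continuous.inv₀ (by fun_prop) fun x => (hs x).ne'
    fun_prop
  have hb : MemLp (fun x => (√(1 + ‖x‖ ^ 2))⁻¹ • (u x - c)) 2 ν := by
    refine huc2.mono hbc.aestronglyMeasurable (Eventually.of_forall fun x => ?_)
    rw [norm_smul, norm_inv, Real.norm_of_nonneg (hs x).le]
    refine mul_le_of_le_one_left (norm_nonneg _) (inv_le_one_of_one_le₀ ?_)
    rw [Real.one_le_sqrt]
    linarith [sq_nonneg ‖x‖]
  have hshift : ∫ x, inner ℝ x (u x) ∂ν =
      ∫ x, inner ℝ (√(1 + ‖x‖ ^ 2) • x) ((√(1 + ‖x‖ ^ 2))⁻¹ • (u x - c)) ∂ν := by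
    have h1 : ∀ x : EuclideanSpace ℝ (Fin d),
        inner ℝ (√(1 + ‖x‖ ^ 2) • x) ((√(1 + ‖x‖ ^ 2))⁻¹ • (u x - c)) =
        inner ℝ x (u x) - inner ℝ c x := fun x => by
      rw [real_inner_smul_left, real_inner_smul_right, ← mul_assoc,
        mul_inv_cancel₀ (hs x).ne', one_mul, inner_sub_right, real_inner_comm c x]
    simp_rw [h1]
    rw [integral_sub (hx.integrable_real_inner hu2)
      ((memLp_const c).integrable_real_inner hx), integral_inner (hx.integrable one_le_two), hmean]
    simp
  have hbK : ∫ x, ‖(√(1 + ‖x‖ ^ 2))⁻¹ • (u x - c)‖ ^ 2 ∂ν ≤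
      K.toReal * ∫ x, ‖hsVec (grad u x)‖ ^ 2 ∂ν := by
    have hp : 0 ≤ ∫ x, ‖hsVec (grad u x)‖ ^ 2 ∂ν := integral_nonneg fun x => by positivity
    rw [← ENNReal.ofReal_le_ofReal_iff (by positivity), ENNReal.ofReal_mul ENNReal.toReal_nonneg,
      ENNReal.ofReal_toReal hK,
      ofReal_integral_eq_lintegral_ofReal (hb.integrable_norm_pow two_ne_zero)
        (Eventually.of_forall fun x => by positivity),
      ofReal_integral_eq_lintegral_ofReal (hgrad.integrable_norm_pow two_ne_zero)
        (Eventually.of_forall fun x => by positivity)]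
    have hDm : Measurable fun x => ‖fderiv ℝ u x‖ₑ ^ 2 :=
      (hu1.continuous_fderiv one_ne_zero).enorm.measurable.pow_const 2
    calc ∫⁻ x, ENNReal.ofReal (‖(√(1 + ‖x‖ ^ 2))⁻¹ • (u x - c)‖ ^ 2) ∂ν
        = ∫⁻ x, ‖u x - c‖ₑ ^ 2 * (1 + ‖x‖ₑ ^ 2)⁻¹ ∂ν := by
          refine lintegral_congr fun x => ?_
          rw [norm_smul, mul_pow, norm_inv, Real.norm_of_nonneg (hs x).le, inv_pow,
            Real.sq_sqrt (by positivity), mul_comm, ENNReal.ofReal_mul (by positivity),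
            ENNReal.ofReal_inv_of_pos (by positivity), ENNReal.ofReal_add zero_le_one
            (by positivity), ENNReal.ofReal_one, ENNReal.ofReal_pow (norm_nonneg _),
            ENNReal.ofReal_pow (norm_nonneg _), ofReal_norm, ofReal_norm]
      _ = ∫⁻ x, ‖u x - c‖ₑ ^ 2 * (1 + ‖x‖ₑ ^ 2)⁻¹ * w x :=
          hlint _ (((show Continuous fun x => ‖u x - c‖ₑ by fun_prop).measurable.pow_const 2).mul
            ((measurable_enorm.pow_const 2).const_add 1).inv)
      _ ≤ K * ∫⁻ x, ‖fderiv ℝ u x‖ₑ ^ 2 * w x := hc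
      _ = K * ∫⁻ x, ‖fderiv ℝ u x‖ₑ ^ 2 ∂ν := by rw [hlint _ hDm]
      _ ≤ K * ∫⁻ x, ENNReal.ofReal (‖hsVec (grad u x)‖ ^ 2) ∂ν := by
          gcongr with x
          rw [ENNReal.ofReal_pow (norm_nonneg _), ← ofReal_norm]
          gcongr
          exact norm_fderiv_le_norm_hsVec_grad u x
  rw [hshift]
  refine (ha.abs_integral_inner_le hb).trans ?_
  rw [mul_assoc, ← Real.sqrt_mul ENNReal.toReal_nonneg]
  gcongr

end Existence

end SteinKernel

/-! ### Cauchy distributions and exponentials of powers of convex functions -/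

namespace SteinKernel

section Examples

variable {d : ℕ}

theorem integral_pos_of_forall_pos {f : EuclideanSpace ℝ (Fin d) → ℝ} (hf : ∀ x, 0 < f x)
    (hfi : Integrable f) : 0 < ∫ x, f x := by
  rw [integral_pos_iff_support_of_nonneg (fun x => (hf x).le) hfi,
    show Function.support f = Set.univ from Set.eq_univ_of_forall fun x => (hf x).ne']
  simp [NeZero.pos]

theorem isProbabilityMeasure_normalizedMeasure {f : EuclideanSpace ℝ (Fin d) → ℝ}
    (hf : ∀ x, 0 < f x) (hfi : Integrable f) : IsProbabilityMeasure (normalizedMeasure f) := by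
  have hZ := integral_pos_of_forall_pos hf hfi
  constructor
  rw [normalizedMeasure, withDensity_apply _ MeasurableSet.univ, Measure.restrict_univ,
    ← ofReal_integral_eq_lintegral_ofReal (hfi.const_mul _)
      (Eventually.of_forall fun x => mul_nonneg (inv_nonneg.2 hZ.le) (hf x).le),
    integral_const_mul, inv_mul_cancel₀ hZ.ne', ENNReal.ofReal_one]

theorem integrable_of_isProbabilityMeasure_normalizedMeasure
    {f : EuclideanSpace ℝ (Fin d) → ℝ} (h : IsProbabilityMeasure (normalizedMeasure f)) :
    Integrable f := by
  by_contra hf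
  -- Otherwise the junk value `0` of the integral makes the measure vanish.
  have h1 := h.measure_univ
  simp [normalizedMeasure, integral_undef hf] at h1

theorem integral_id_normalizedMeasure_eq_zero {f : EuclideanSpace ℝ (Fin d) → ℝ}
    (hfc : Continuous f) (heven : ∀ x, f (-x) = f x) : ∫ x, x ∂(normalizedMeasure f) = 0 := by
  rw [normalizedMeasure, integral_withDensity_eq_integral_toReal_smul (by fun_prop) (by simp)]
  have h := integral_neg_eq_self (fun x : EuclideanSpace ℝ (Fin d) =>
    (ENNReal.ofReal ((∫ y, f y)⁻¹ * f x)).toReal • x) volume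
  simp only [heven, smul_neg, integral_neg] at h
  have key : ∀ v : EuclideanSpace ℝ (Fin d), -v = v → v = 0 := fun v hv => by
    refine (smul_eq_zero.1 (?_ : (2 : ℝ) • v = 0)).resolve_left two_ne_zero
    rw [two_smul]
    exact add_eq_zero_iff_eq_neg.2 hv.symm
  exact key _ h

theorem exists_isSteinKernel_normalizedMeasure {f : EuclideanSpace ℝ (Fin d) → ℝ}
    (hfc : Continuous f) (hf : ∀ x, 0 < f x) (hfi : Integrable f)
    (hmom : Integrable fun x => ‖x‖ ^ 4 * f x) {R : ℝ} (hR : 0 < R)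
    (hdecay : ∀ x, R ≤ ‖x‖ → ∀ l ∈ Set.Icc (1 : ℝ) 2, l ^ d * f (l • x) ≤ l * f x)
    (hmean : ∫ x, x ∂(normalizedMeasure f) = 0) :
    ∃ τ, IsSteinKernel (normalizedMeasure f) τ := by
  have hZ := inv_pos.2 (integral_pos_of_forall_pos hf hfi)
  have := isProbabilityMeasure_normalizedMeasure hf hfi
  refine exists_isSteinKernel_withDensity (ρ := fun x => (∫ y, f y)⁻¹ * f x) (by fun_prop)
    (fun x => mul_pos hZ (hf x)) hR (fun x hx l hl => ?_) rfl ?_ hmean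
  · rw [mul_left_comm, mul_left_comm l]
    exact mul_le_mul_of_nonneg_left (hdecay x hx l hl) hZ.le
  · rw [normalizedMeasure, integrable_withDensity_iff (by fun_prop) (by simp)]
    refine (hmom.const_mul (∫ y, f y)⁻¹).congr (Eventually.of_forall fun x => ?_)
    simp only [ENNReal.toReal_ofReal (mul_pos hZ (hf x)).le]
    ring

theorem exists_isSteinKernel_generalizedCauchy {β : ℝ}
    (hβ : max (((d : ℝ) + 4) / 2) (d : ℝ) < β) :
    IsProbabilityMeasure (generalizedCauchy d β) ∧
      ∃ τ, IsSteinKernel (generalizedCauchy d β) τ := by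
  obtain ⟨h1, h2⟩ := max_lt_iff.1 hβ
  have hpos : ∀ x : EuclideanSpace ℝ (Fin d), 0 < 1 + ‖x‖ ^ 2 := fun x => by positivity
  have hfc : Continuous fun x : EuclideanSpace ℝ (Fin d) => (1 + ‖x‖ ^ 2) ^ (-β) :=
    Continuous.rpow_const (by fun_prop) fun x => Or.inl (hpos x).ne'
  have hf : ∀ x : EuclideanSpace ℝ (Fin d), 0 < (1 + ‖x‖ ^ 2) ^ (-β) := fun x =>
    Real.rpow_pos_of_pos (hpos x) _
  have hint : ∀ s : ℝ, (d : ℝ) < 2 * s →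
      Integrable fun x : EuclideanSpace ℝ (Fin d) => (1 + ‖x‖ ^ 2) ^ (-s) := fun s hs => by
    have h := integrable_rpow_neg_one_add_norm_sq (E := EuclideanSpace ℝ (Fin d))
      (μ := volume) (r := 2 * s) (by simpa using hs)
    simpa [neg_div] using h
  have hfi := hint β (by linarith [(Nat.cast_nonneg d : (0 : ℝ) ≤ d)])
  refine ⟨isProbabilityMeasure_normalizedMeasure hf hfi,
    exists_isSteinKernel_normalizedMeasure hfc hf hfi ?_ one_pos (fun x hx l hl => ?_)
    (integral_id_normalizedMeasure_eq_zero hfc (by simp))⟩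
  · refine (hint (β - 2) (by linarith)).mono' (by fun_prop) (Eventually.of_forall fun x => ?_)
    rw [Real.norm_of_nonneg (mul_nonneg (by positivity) (hf x).le),
      show -(β - 2) = -β + (2 : ℕ) by push_cast; ring, Real.rpow_add_natCast (hpos x).ne',
      mul_comm]
    refine mul_le_mul_of_nonneg_left ?_ (hf x).le
    nlinarith [sq_nonneg ‖x‖]
  · have hl0 : 0 < l := by linarith [hl.1]
    have hβ0 : 0 ≤ β := by linarith [(Nat.cast_nonneg d : (0 : ℝ) ≤ d)]
    have hle : l * (1 + ‖x‖ ^ 2) ≤ 1 + ‖l • x‖ ^ 2 := by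
      rw [norm_smul, Real.norm_of_nonneg hl0.le]
      have : 0 ≤ (l - 1) * (l * ‖x‖ ^ 2 - 1) :=
        mul_nonneg (by linarith [hl.1]) (by nlinarith [hl.1])
      nlinarith
    have hpow : l ^ d * l ^ (-β) ≤ l := by
      rw [← Real.rpow_natCast, ← Real.rpow_add hl0]
      exact (Real.rpow_le_one_of_one_le_of_nonpos hl.1 (by linarith)).trans hl.1
    calc l ^ d * (1 + ‖l • x‖ ^ 2) ^ (-β) ≤ l ^ d * (l * (1 + ‖x‖ ^ 2)) ^ (-β) := by
          refine mul_le_mul_of_nonneg_left ?_ (by positivity)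
          exact Real.rpow_le_rpow_of_nonpos (by positivity) hle (by linarith)
      _ = l ^ d * l ^ (-β) * (1 + ‖x‖ ^ 2) ^ (-β) := by
          rw [Real.mul_rpow hl0.le (hpos x).le, mul_assoc]
      _ ≤ l * (1 + ‖x‖ ^ 2) ^ (-β) := mul_le_mul_of_nonneg_right hpow (hf x).le

/-- A convex set of finite measure with the origin in its interior is bounded: a long segment from
the origin would force it to contain many disjoint balls of the same radius. -/
theorem _root_.Convex.exists_norm_le_of_measure_lt_top {E : Type*} [NormedAddCommGroup E]
    [NormedSpace ℝ E] [FiniteDimensional ℝ E] [MeasurableSpace E] [BorelSpace E] (μ : Measure E)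
    [μ.IsAddHaarMeasure] {S : Set E} (hS : Convex ℝ S) {δ : ℝ} (hδ : 0 < δ)
    (hball : Metric.ball 0 δ ⊆ S) (hfin : μ S ≠ ⊤) : ∃ r, ∀ x ∈ S, ‖x‖ ≤ r := by
  have hv : μ (Metric.ball 0 (δ / 2)) ≠ 0 := (Metric.measure_ball_pos μ _ (by positivity)).ne'
  obtain ⟨N, hN⟩ := ENNReal.exists_nat_mul_gt hv hfin
  refine ⟨2 * δ * N, fun x hx => ?_⟩
  by_contra! hlt
  have hx0 : 0 < ‖x‖ := lt_of_le_of_lt (by positivity) hlt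
  refine hN.not_ge ?_
  have hsub : ∀ j ∈ Finset.range N, Metric.ball (((j : ℝ) * δ / ‖x‖) • x) (δ / 2) ⊆ S := by
    intro j hj y hy
    set t : ℝ := j * δ / ‖x‖ with ht
    have ht0 : 0 ≤ t := by positivity
    have ht1 : t ≤ 1 / 2 := by
      have : (j : ℝ) ≤ N := by exact_mod_cast (Finset.mem_range.1 hj).le
      rw [ht, div_le_iff₀ hx0]
      nlinarith
    have hz : (1 - t)⁻¹ • (y - t • x) ∈ S := by
      refine hball ?_
      rw [mem_ball_zero_iff, norm_smul, norm_inv, Real.norm_of_nonneg (by linarith),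
        inv_mul_lt_iff₀ (by linarith)]
      rw [mem_ball_iff_norm] at hy
      nlinarith
    have := hS hx hz ht0 (by linarith : 0 ≤ 1 - t) (by ring)
    rwa [smul_smul, mul_inv_cancel₀ (by linarith), one_smul, add_sub_cancel] at this
  have hdisj : Set.PairwiseDisjoint (Finset.range N : Set ℕ)
      fun j : ℕ => Metric.ball (((j : ℝ) * δ / ‖x‖) • x) (δ / 2) := by
    intro i _ j _ hij
    refine Metric.ball_disjoint_ball ?_
    rw [dist_eq_norm, ← sub_smul, norm_smul, ← sub_div, ← sub_mul, norm_div, norm_norm,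
      div_mul_cancel₀ _ hx0.ne', norm_mul, Real.norm_of_nonneg hδ.le]
    have h1 : (1 : ℝ) ≤ ‖(i : ℝ) - j‖ := by
      have h2 : (1 : ℤ) ≤ |(i : ℤ) - j| := Int.one_le_abs (by omega)
      rw [Real.norm_eq_abs]
      exact_mod_cast h2
    nlinarith
  calc (N : ENNReal) * μ (Metric.ball 0 (δ / 2))
      = ∑ j ∈ Finset.range N, μ (Metric.ball (((j : ℝ) * δ / ‖x‖) • x) (δ / 2)) := by
        simp [Measure.addHaar_ball_center μ]
    _ = μ (⋃ j ∈ Finset.range N, Metric.ball (((j : ℝ) * δ / ‖x‖) • x) (δ / 2)) :=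
        (measure_biUnion_finset hdisj fun _ _ => measurableSet_ball).symm
    _ ≤ μ S := measure_mono (Set.iUnion₂_subset hsub)

theorem continuous_of_convexOn_univ {V : EuclideanSpace ℝ (Fin d) → ℝ}
    (hV : ConvexOn ℝ Set.univ V) : Continuous V :=
  continuousOn_univ.1 (hV.continuousOn isOpen_univ)

/-- Finite mass forces a convex potential to grow at least linearly. -/
theorem exists_norm_le_mul_of_integrable {V : EuclideanSpace ℝ (Fin d) → ℝ} {p : ℝ}
    (hV : ConvexOn ℝ Set.univ V) (hV0 : ∀ x, 0 ≤ V x) (hp : 0 < p)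
    (hint : Integrable fun x => Real.exp (-(V x) ^ p)) :
    ∃ r, 0 < r ∧ ∀ x, r ≤ ‖x‖ → ‖x‖ ≤ r * V x := by
  set S : Set (EuclideanSpace ℝ (Fin d)) := {x | x ∈ Set.univ ∧ V x ≤ V 0 + 1} with hSdef
  have hfin : volume S ≠ ⊤ := by
    refine ne_top_of_le_ne_top
      (hint.measure_ge_lt_top (Real.exp_pos (-(V 0 + 1) ^ p))).ne (measure_mono fun x hx => ?_)
    exact Real.exp_le_exp.2 (neg_le_neg (Real.rpow_le_rpow (hV0 x) hx.2 hp.le))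
  obtain ⟨δ, hδ, hball⟩ : ∃ δ > 0, Metric.ball 0 δ ⊆ S := by
    have h : ∀ᶠ x in 𝓝 0, V x < V 0 + 1 :=
      (continuous_of_convexOn_univ hV).continuousAt.eventually_lt_const (by linarith)
    obtain ⟨δ, hδ, h⟩ := Metric.eventually_nhds_iff_ball.1 h
    exact ⟨δ, hδ, fun x hx => ⟨trivial, (h x hx).le⟩⟩
  obtain ⟨r, hr⟩ := (hV.convex_le (V 0 + 1)).exists_norm_le_of_measure_lt_top volume hδ hball hfin
  have hr0 : 0 ≤ r := (norm_nonneg _).trans (hr 0 (hball (Metric.mem_ball_self hδ)))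
  refine ⟨r + 1, by linarith, fun x hx => ?_⟩
  have hx0 : 0 < ‖x‖ := by linarith
  have hs0 : 0 ≤ (r + 1) / ‖x‖ := by positivity
  have hs1 : (r + 1) / ‖x‖ ≤ 1 := (div_le_one hx0).2 hx
  have hconv := hV.2 (Set.mem_univ x) (Set.mem_univ 0) hs0 (sub_nonneg.2 hs1) (by ring)
  have hout : V 0 + 1 < V (((r + 1) / ‖x‖) • x) := by
    by_contra! h
    have := hr _ ⟨Set.mem_univ _, h⟩
    rw [norm_smul, Real.norm_of_nonneg hs0, div_mul_cancel₀ _ hx0.ne'] at this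
    linarith
  rw [smul_zero, add_zero, smul_eq_mul, smul_eq_mul] at hconv
  have h1 : 1 ≤ (r + 1) / ‖x‖ * V x := by nlinarith [mul_nonneg hs0 (hV0 0)]
  rwa [div_mul_eq_mul_div, one_le_div hx0] at h1

theorem integrable_norm_pow_mul_exp_neg_rpow {V : EuclideanSpace ℝ (Fin d) → ℝ} {p r : ℝ}
    (hVc : Continuous V) (hV0 : ∀ x, 0 ≤ V x) (hp : 0 < p) (hr : 0 < r)
    (hgrow : ∀ x, r ≤ ‖x‖ → ‖x‖ ≤ r * V x) (n : ℕ) :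
    Integrable fun x => ‖x‖ ^ n * Real.exp (-(V x) ^ p) := by
  set k := n + (d + 1) with hk
  obtain ⟨m, hm⟩ := exists_nat_ge ((k : ℝ) / p)
  rw [div_le_iff₀ hp] at hm
  have hm1 : (1 : ℝ) ≤ m.factorial := by exact_mod_cast Nat.one_le_iff_ne_zero.2 (by positivity)
  -- For `‖x‖ ≥ r` this rests on `exp s ≥ s ^ m / m!` with `s = V x ^ p` and `p * m ≥ k`.
  have hbound : ∀ x, (1 + ‖x‖) ^ k * Real.exp (-(V x) ^ p) ≤ m.factorial * (1 + r) ^ k := by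
    intro x
    have hVp : 0 ≤ V x ^ p := Real.rpow_nonneg (hV0 x) p
    rcases le_total ‖x‖ r with h | h
    · calc (1 + ‖x‖) ^ k * Real.exp (-(V x) ^ p) ≤ (1 + r) ^ k * 1 := by
            gcongr
            exact Real.exp_le_one_iff.2 (by linarith)
        _ ≤ _ := by
            rw [mul_comm]
            gcongr
    · have hV1 : ‖x‖ / r ≤ V x := (div_le_iff₀' hr).2 (hgrow x h)
      have h1 : 1 ≤ V x := ((one_le_div hr).2 h).trans hV1
      have h2 : (‖x‖ / r) ^ k ≤ m.factorial * Real.exp (V x ^ p) := by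
        calc (‖x‖ / r) ^ k ≤ V x ^ k := by gcongr
          _ = V x ^ (k : ℝ) := (Real.rpow_natCast _ _).symm
          _ ≤ V x ^ (p * m) := Real.rpow_le_rpow_of_exponent_le h1 (by linarith)
          _ = (V x ^ p) ^ m := by rw [Real.rpow_mul (hV0 x), Real.rpow_natCast]
          _ ≤ m.factorial * Real.exp (V x ^ p) := by
            have := Real.pow_div_factorial_le_exp _ hVp m
            rwa [div_le_iff₀' (by positivity)] at this
      have h3 : 1 + ‖x‖ ≤ (1 + r) * (‖x‖ / r) := by
        have : 1 ≤ ‖x‖ / r := (one_le_div hr).2 h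
        have h4 : r * (‖x‖ / r) = ‖x‖ := mul_div_cancel₀ _ hr.ne'
        linarith
      calc (1 + ‖x‖) ^ k * Real.exp (-(V x) ^ p)
          ≤ ((1 + r) * (‖x‖ / r)) ^ k * Real.exp (-(V x) ^ p) := by gcongr
        _ ≤ (1 + r) ^ k * (m.factorial * Real.exp (V x ^ p)) * Real.exp (-(V x) ^ p) := by
            rw [mul_pow]
            gcongr
        _ = m.factorial * (1 + r) ^ k * (Real.exp (V x ^ p) * Real.exp (-(V x) ^ p)) := by ring
        _ = _ := by rw [← Real.exp_add, add_neg_cancel, Real.exp_zero, mul_one]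
  have hi := integrable_one_add_norm (E := EuclideanSpace ℝ (Fin d)) (μ := volume)
    (r := ((d + 1 : ℕ) : ℝ)) (by simp)
  have hVpc : Continuous fun x => V x ^ p := hVc.rpow_const fun _ => Or.inr hp.le
  refine (hi.const_mul (m.factorial * (1 + r) ^ k)).mono' (by fun_prop)
    (Eventually.of_forall fun x => ?_)
  rw [Real.norm_of_nonneg (by positivity), Real.rpow_neg (by positivity), Real.rpow_natCast,
    ← div_eq_mul_inv, le_div_iff₀ (by positivity)]
  refine le_trans ?_ (hbound x)
  rw [hk, pow_add _ n, mul_right_comm]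
  gcongr
  linarith [norm_nonneg x]

/-- The radial decay of `exp (-V ^ p)`: convexity gives `V (l • x) ≥ V x * (1 + l) / 2` far from
the origin, so that `V ^ p` grows along rays at least like a large multiple of the logarithm. -/
theorem pow_mul_exp_neg_rpow_le {V : EuclideanSpace ℝ (Fin d) → ℝ} {p : ℝ}
    (hV : ConvexOn ℝ Set.univ V) (hp : 0 < p) {x : EuclideanSpace ℝ (Fin d)}
    (hVx : 0 < V x) (hx : 2 * V 0 ≤ V x) (hxp : 2 * d ≤ p * V x ^ p) {l : ℝ} (hl : 1 ≤ l) :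
    l ^ d * Real.exp (-(V (l • x)) ^ p) ≤ l * Real.exp (-(V x) ^ p) := by
  have hl0 : 0 < l := by linarith
  have hlog := Real.log_nonneg hl
  have hconv := hV.2 (Set.mem_univ (l • x)) (Set.mem_univ 0) (inv_nonneg.2 hl0.le)
    (sub_nonneg.2 (inv_le_one_of_one_le₀ hl)) (by ring)
  rw [smul_zero, add_zero, smul_smul, inv_mul_cancel₀ hl0.ne', one_smul, smul_eq_mul,
    smul_eq_mul] at hconv
  have h1 : l * V x ≤ V (l • x) + (l - 1) * V 0 := by
    calc l * V x ≤ l * (l⁻¹ * V (l • x) + (1 - l⁻¹) * V 0) := by gcongr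
      _ = V (l • x) + (l - 1) * V 0 := by field_simp
  have h2 : V x * Real.exp (Real.log l / 2) ≤ V (l • x) := by
    have h3 : Real.exp (Real.log l / 2) ^ 2 = l := by
      rw [← Real.exp_nat_mul]
      push_cast
      rw [mul_div_cancel₀ _ two_ne_zero, Real.exp_log hl0]
    have h4 : Real.exp (Real.log l / 2) ≤ (1 + l) / 2 := by
      nlinarith [sq_nonneg (Real.exp (Real.log l / 2) - 1)]
    nlinarith
  have h5 : V x ^ p + d * Real.log l ≤ V (l • x) ^ p := by
    calc V x ^ p + d * Real.log l ≤ V x ^ p * (Real.log l / 2 * p + 1) := by nlinarith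
      _ ≤ V x ^ p * Real.exp (Real.log l / 2 * p) := by
        gcongr
        exact Real.add_one_le_exp _
      _ = (V x * Real.exp (Real.log l / 2)) ^ p := by
        rw [Real.mul_rpow hVx.le (Real.exp_pos _).le, Real.exp_mul]
      _ ≤ V (l • x) ^ p := by gcongr
  calc l ^ d * Real.exp (-(V (l • x)) ^ p)
      = Real.exp (d * Real.log l - V (l • x) ^ p) := by
        rw [sub_eq_add_neg, Real.exp_add, Real.exp_nat_mul, Real.exp_log hl0]
    _ ≤ Real.exp (-(V x) ^ p) := Real.exp_le_exp.2 (by linarith)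
    _ ≤ l * Real.exp (-(V x) ^ p) := le_mul_of_one_le_left (Real.exp_pos _).le hl

theorem exists_isSteinKernel_expPowMeasure {V : EuclideanSpace ℝ (Fin d) → ℝ} {p r : ℝ}
    (hV : ConvexOn ℝ Set.univ V) (hV0 : ∀ x, 0 ≤ V x) (hp : 0 < p) (hr : 0 < r)
    (hgrow : ∀ x, r ≤ ‖x‖ → ‖x‖ ≤ r * V x) (hmean : ∫ x, x ∂(expPowMeasure V p) = 0) :
    ∃ τ, IsSteinKernel (expPowMeasure V p) τ := by
  have hVc := continuous_of_convexOn_univ hV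
  have hVpc : Continuous fun x => V x ^ p := hVc.rpow_const fun _ => Or.inr hp.le
  have hmom := integrable_norm_pow_mul_exp_neg_rpow hVc hV0 hp hr hgrow
  set q : ℝ := 1 + 2 * V 0 + (2 * d / p) ^ p⁻¹ with hq
  have hpd : 0 ≤ 2 * (d : ℝ) / p := by positivity
  have hq1 : 0 ≤ (2 * (d : ℝ) / p) ^ p⁻¹ := Real.rpow_nonneg hpd _
  have h0 := hV0 0
  refine exists_isSteinKernel_normalizedMeasure (R := r * q) (by fun_prop)
    (fun x => Real.exp_pos _) (by simpa using hmom 0) (hmom 4) (mul_pos hr (by linarith))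
    (fun x hx l hl => ?_) hmean
  have hVx : q ≤ V x := by
    have h1 : r ≤ ‖x‖ := le_trans (le_mul_of_one_le_right hr.le (by linarith)) hx
    exact le_of_mul_le_mul_left (hx.trans (hgrow x h1)) hr
  refine pow_mul_exp_neg_rpow_le hV hp (by linarith) (by linarith) ?_ hl.1
  rw [← div_le_iff₀' hp]
  calc 2 * (d : ℝ) / p = ((2 * d / p) ^ p⁻¹) ^ p := by
        rw [← Real.rpow_mul hpd, inv_mul_cancel₀ hp.ne', Real.rpow_one]
    _ ≤ V x ^ p := Real.rpow_le_rpow hq1 (by linarith) hp.le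

end Examples

end SteinKernel

theorem corollary2p4 (d : ℕ) :
    (∀ β : ℝ, max (((d : ℝ) + 4) / 2) (d : ℝ) < β →
      IsProbabilityMeasure (SteinKernel.generalizedCauchy d β) ∧
      ∃ τ, SteinKernel.IsSteinKernel (SteinKernel.generalizedCauchy d β) τ) ∧
    (∀ (V : EuclideanSpace ℝ (Fin d) → ℝ) (p : ℝ),
      ConvexOn ℝ Set.univ V → (∀ x, 0 ≤ V x) → 0 < p →
      IsProbabilityMeasure (SteinKernel.expPowMeasure V p) →
      ∫ x, x ∂(SteinKernel.expPowMeasure V p) = 0 →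
      Integrable (fun x => ‖x‖ ^ (2 + 2 * (1 - p))) (SteinKernel.expPowMeasure V p) →
      ∃ τ, SteinKernel.IsSteinKernel (SteinKernel.expPowMeasure V p) τ) ∧
    (∀ p : ℝ, p ∈ Set.Ioo (0 : ℝ) 1 →
      IsProbabilityMeasure
        (SteinKernel.expPowMeasure (fun x : EuclideanSpace ℝ (Fin d) => ‖x‖) p) ∧
      ∃ τ, SteinKernel.IsSteinKernel
        (SteinKernel.expPowMeasure (fun x : EuclideanSpace ℝ (Fin d) => ‖x‖) p) τ) := by
  refine ⟨fun β hβ => SteinKernel.exists_isSteinKernel_generalizedCauchy hβ,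
    fun V p hV hV0 hp hprob hmean _ => ?_, fun p hp => ⟨?_, ?_⟩⟩
  · obtain ⟨r, hr, hgrow⟩ := SteinKernel.exists_norm_le_mul_of_integrable hV hV0 hp
      (SteinKernel.integrable_of_isProbabilityMeasure_normalizedMeasure hprob)
    exact SteinKernel.exists_isSteinKernel_expPowMeasure hV hV0 hp hr hgrow hmean
  · refine SteinKernel.isProbabilityMeasure_normalizedMeasure (fun x => Real.exp_pos _) ?_
    simpa using SteinKernel.integrable_norm_pow_mul_exp_neg_rpow (d := d) continuous_norm
      norm_nonneg hp.1 one_pos (by simp) 0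
  · have hc : Continuous fun x : EuclideanSpace ℝ (Fin d) => ‖x‖ ^ p :=
      continuous_norm.rpow_const fun _ => Or.inr hp.1.le
    exact SteinKernel.exists_isSteinKernel_expPowMeasure (convexOn_norm convex_univ) norm_nonneg
      hp.1 one_pos (by simp)
      (SteinKernel.integral_id_normalizedMeasure_eq_zero (by fun_prop) (by simp))
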